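/- Let $\mathcal X,\mathcal Y\subset\mathbb R$ be closed bounded intervals and let $F=\{F(x,y):(x,y)\in\mathcal X\times\mathcal Y\}$ be a real stochastic process on a probability space with $\mathsf E F(x,y)=0$ and $\mathsf E F(x,y)^2<\infty$ for all $(x,y)$. Write $\kappa\{(x,y),(x',y')\}=\mathsf{cov}\{F(x,y),F(x',y')\}$. Call $\kappa$ separable if $\kappa\{(x,y),(x',y')\}=\kappa_x(x,x')\,\kappa_y(y,y')$ for all arguments, for some real functions $\kappa_x$ on $\mathcal X\times\mathcal X$ and $\kappa_y$ on $\mathcal Y\times\mathcal Y$. For continuous functions $g_1,g_2,\dots$ on $\mathcal X$, continuous functions $h_1,h_2,\dots$ on $\mathcal Y$ and random variables $Z_{ij}$, put $$F^{(n)}(x,y)=\sum_{i=1}^n\sum_{j=1}^n Z_{ij}\,g_i(x)\,h_j(y).$$ A family of $Z_{ij}$ is called orthonormal if $\mathsf E Z_{ij}=0$, $\mathsf E Z_{ij}^2<\infty$ and $\mathsf E(Z_{ij}Z_{i'j'})=\delta_{ii'}\delta_{jj'}$ for all its members. (1) The covariance function $\kappa$ is continuous and separable if and only if there are such $g_i$,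 $h_j$, $Z_{ij}$, with the family of those $Z_{ij}$ for which neither $g_i$ nor $h_j$ is identically zero orthonormal, such that either, for some finite $n\ge 0$, $F(x,y)=F^{(n)}(x,y)$ almost surely for every $(x,y)$ (in this case only the indices $i,j\le n$ matter), or $\mathsf E\{(F^{(n)}(x,y)-F(x,y))^2\}\to0$ as $n\to\infty$, uniformly on $\mathcal X\times\mathcal Y$. (2) If the probability space carries an infinite sequence of centred orthonormal random variables that are uncorrelated with every $F(x,y)$, then the equivalence in (1) also holds with the requirement that all the $Z_{ij}$ ($i,j\le n$ in the finite case, $i,j\ge1$ in the limit case) be orthonormal. -/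

import Mathlib

open MeasureTheory ProbabilityTheory Filter

namespace SeparableCovariance

variable {Ω X Y : Type*} [MeasurableSpace Ω] [TopologicalSpace X] [TopologicalSpace Y]

/-- A real stochastic process on `X × Y` consisting of centred random variables with finite
second moments. -/
structure IsCentredSecondOrder (P : Measure Ω) (F : X → Y → Ω → ℝ) : Prop where
  memLp : ∀ x y, MemLp (F x y) 2 P
  centred : ∀ x y, ∫ ω, F x y ω ∂P = 0

/-- The covariance function `κ((x, y), (x', y')) = cov(F(x, y), F(x', y'))`. -/
noncomputable def covFun (P : Measure Ω) (F : X → Y → Ω → ℝ) (p q : X × Y) : ℝ :=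
  cov[F p.1 p.2, F q.1 q.2; P]

/-- The covariance function factorises into a function of `(x, x')` times a function of
`(y, y')`. -/
def IsSeparable (κ : X × Y → X × Y → ℝ) : Prop :=
  ∃ (κx : X → X → ℝ) (κy : Y → Y → ℝ),
    ∀ x y x' y', κ (x, y) (x', y') = κx x x' * κy y y'

/-- `F` has a continuous separable covariance function. -/
def HasContinuousSeparableCov (P : Measure Ω) (F : X → Y → Ω → ℝ) : Prop :=
  Continuous (fun r : (X × Y) × (X × Y) => covFun P F r.1 r.2) ∧ IsSeparable (covFun P F)

/-- The random variables `Z i j` with `(i, j) ∈ S` are centred, square integrable and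
orthonormal. -/
structure IsOrthonormalOn (P : Measure Ω) (Z : ℕ → ℕ → Ω → ℝ) (S : Set (ℕ × ℕ)) : Prop where
  memLp : ∀ s ∈ S, MemLp (Z s.1 s.2) 2 P
  centred : ∀ s ∈ S, ∫ ω, Z s.1 s.2 ω ∂P = 0
  inner_eq : ∀ s ∈ S, ∀ t ∈ S,
    ∫ ω, Z s.1 s.2 ω * Z t.1 t.2 ω ∂P = if s = t then 1 else 0

/-- `F⁽ⁿ⁾(x, y) = ∑_{i < n} ∑_{j < n} Z_{ij} g_i(x) h_j(y)` (indices start at `0`). -/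
noncomputable def doubleSum (Z : ℕ → ℕ → Ω → ℝ) (g : ℕ → C(X, ℝ)) (h : ℕ → C(Y, ℝ))
    (n : ℕ) (x : X) (y : Y) (ω : Ω) : ℝ :=
  ∑ i ∈ Finset.range n, ∑ j ∈ Finset.range n, Z i j ω * g i x * h j y

/-- `G n → F` in quadratic mean, uniformly on `X × Y`. -/
def TendstoQMUniformly (P : Measure Ω) (G : ℕ → X → Y → Ω → ℝ) (F : X → Y → Ω → ℝ) : Prop :=
  TendstoUniformly (fun (n : ℕ) (p : X × Y) => ∫ ω, (G n p.1 p.2 ω - F p.1 p.2 ω) ^ 2 ∂P)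
    (fun _ => 0) atTop

/-- The pairs `(i, j)` for which neither `g i` nor `h j` vanishes identically. -/
def activePairs (g : ℕ → C(X, ℝ)) (h : ℕ → C(Y, ℝ)) : Set (ℕ × ℕ) :=
  {s | g s.1 ≠ 0 ∧ h s.2 ≠ 0}

/-- `F = F⁽ⁿ⁾` almost surely, at each point, for some finite `n`; the `Z i j` that occur with a
coefficient function that is not identically zero are orthonormal. -/
def IsFiniteSum (P : Measure Ω) (F : X → Y → Ω → ℝ) : Prop :=
  ∃ (n : ℕ) (Z : ℕ → ℕ → Ω → ℝ) (g : ℕ → C(X, ℝ)) (h : ℕ → C(Y, ℝ)),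
    IsOrthonormalOn P Z (activePairs g h ∩ {s | s.1 < n ∧ s.2 < n}) ∧
    ∀ x y, F x y =ᵐ[P] doubleSum Z g h n x y

/-- `F` is the limit of `F⁽ⁿ⁾` in quadratic mean, uniformly; the `Z i j` that occur with a
coefficient function that is not identically zero are orthonormal. -/
def IsUniformLimit (P : Measure Ω) (F : X → Y → Ω → ℝ) : Prop :=
  ∃ (Z : ℕ → ℕ → Ω → ℝ) (g : ℕ → C(X, ℝ)) (h : ℕ → C(Y, ℝ)),
    IsOrthonormalOn P Z (activePairs g h) ∧
    TendstoQMUniformly P (doubleSum Z g h) F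

/-- As `IsFiniteSum`, with all `Z i j`, `i, j < n`, orthonormal. -/
def IsFiniteSumFull (P : Measure Ω) (F : X → Y → Ω → ℝ) : Prop :=
  ∃ (n : ℕ) (Z : ℕ → ℕ → Ω → ℝ) (g : ℕ → C(X, ℝ)) (h : ℕ → C(Y, ℝ)),
    IsOrthonormalOn P Z {s | s.1 < n ∧ s.2 < n} ∧
    ∀ x y, F x y =ᵐ[P] doubleSum Z g h n x y

/-- As `IsUniformLimit`, with all `Z i j` orthonormal. -/
def IsUniformLimitFull (P : Measure Ω) (F : X → Y → Ω → ℝ) : Prop :=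
  ∃ (Z : ℕ → ℕ → Ω → ℝ) (g : ℕ → C(X, ℝ)) (h : ℕ → C(Y, ℝ)),
    IsOrthonormalOn P Z Set.univ ∧
    TendstoQMUniformly P (doubleSum Z g h) F

/-- The probability space carries infinitely many orthonormal centred random variables
uncorrelated with the whole process `F`. -/
def HasRoom (P : Measure Ω) (F : X → Y → Ω → ℝ) : Prop :=
  ∃ U : ℕ → Ω → ℝ,
    (∀ k, MemLp (U k) 2 P) ∧ (∀ k, ∫ ω, U k ω ∂P = 0) ∧
    (∀ k l, ∫ ω, U k ω * U l ω ∂P = if k = l then 1 else 0) ∧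
    ∀ k x y, ∫ ω, U k ω * F x y ω ∂P = 0

end SeparableCovariance

/-!
The process is regarded as a map `Φ : X × Y → L²(P)`, so that its covariance function is the Gram
kernel `⟪Φ p, Φ q⟫`.

Suppose the kernel is continuous and separable, and not identically zero. Fixing a point
`(x₀, y₀)` of positive variance, the kernel is the product of the Gram kernels of the two
continuous curves `φ x = Φ (x, y₀)` and `ψ y = Φ (x₀, y) / ‖Φ (x₀, y₀)‖`. Neither Mercer's theorem
nor an integral operator is needed: the Gram-Schmidt process along a dense sequence gives a
countable orthonormal system `e i` of finite linear combinations of values of `φ`, for which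
Parseval's identity `∑ i, ⟪e i, φ x⟫² = ‖φ x‖²` holds at every `x`, and a system `f j` for `ψ`
likewise (`exists_isOrthonormalOrZero_parseval`). The product form of the kernel means that `Φ`
induces an isometry from the tensor product of the spans of `φ` and `ψ`
(`inner_bilinear_lift`). The images `Z i j` of `e i ⊗ f j` are orthonormal, apart from zeros, and
the coefficient of `Φ (x, y)` with respect to `Z i j` is `g i x * h j y`, where
`g i x = ⟪e i, φ x⟫` and `h j y = ⟪f j, ψ y⟫`. The squared error of the `n`-th partial sum is
`‖φ x‖² ‖ψ y‖² - (∑ i < n, g i x ²) (∑ j < n, h j y ²)`, which decreases to zero, uniformly by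
Dini's theorem (`exists_partialSum_tendstoUniformly`). A vector `e i` that vanishes gives `g i = 0`,
so at such indices `Z i j` is arbitrary; variables uncorrelated with the process can be used to
make the whole family orthonormal.

Conversely, a finite sum is the limit of an eventually constant sequence of partial sums, and a
uniform limit of partial sums is continuous in `L²`. The kernels of the partial sums are products,
hence satisfy a quadratic identity that characterises separable kernels and is preserved by
pointwise limits (`continuous_and_isSeparable_of_tendstoUniformly`).
-/

namespace SeparableCovariance

open TopologicalSpace
open scoped RealInnerProductSpace

section Hilbert

variable {ι E X Y : Type*} [NormedAddCommGroup E] [InnerProductSpace ℝ E]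
  [TopologicalSpace X] [TopologicalSpace Y]

/-! ### Orthonormal systems padded with zeros -/

/-- A family of pairwise orthogonal vectors, each of which is zero or a unit vector. Zeros are
allowed so that a countable system can be indexed by `ℕ` whatever the dimension of its span. -/
structure IsOrthonormalOrZero (e : ι → E) : Prop where
  inner_eq_zero : ∀ i j, i ≠ j → ⟪e i, e j⟫ = 0
  zero_or_unit : ∀ i, e i = 0 ∨ ‖e i‖ = 1

theorem isOrthonormalOrZero_gramSchmidtNormed (v : ℕ → E) :
    IsOrthonormalOrZero (InnerProductSpace.gramSchmidtNormed ℝ v) where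
  inner_eq_zero i j hij := by
    simp [InnerProductSpace.gramSchmidtNormed, inner_smul_left, inner_smul_right,
      InnerProductSpace.gramSchmidt_orthogonal ℝ v hij]
  zero_or_unit i := by
    by_cases h : InnerProductSpace.gramSchmidtNormed ℝ v i = 0
    · exact Or.inl h
    · exact Or.inr (InnerProductSpace.gramSchmidtNormed_unit_length' h)

namespace IsOrthonormalOrZero

variable {e : ι → E}

theorem inner_sum_smul (he : IsOrthonormalOrZero e) {s : Finset ι} {i : ι} (hi : i ∈ s)
    (c : ι → ℝ) : ⟪e i, ∑ j ∈ s, c j • e j⟫ = c i * ‖e i‖ ^ 2 := by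
  rw [inner_sum, Finset.sum_eq_single_of_mem i hi]
  · rw [inner_smul_right, real_inner_self_eq_norm_sq]
  · intro j _ hj
    rw [inner_smul_right, he.inner_eq_zero i j hj.symm, mul_zero]

theorem inner_mul_norm_sq (he : IsOrthonormalOrZero e) (i : ι) (v : E) :
    ⟪e i, v⟫ * ‖e i‖ ^ 2 = ⟪e i, v⟫ := by
  rcases he.zero_or_unit i with h | h <;> simp [h]

/-- The error in Bessel's inequality. -/
theorem norm_sub_sum_sq (he : IsOrthonormalOrZero e) (s : Finset ι) (v : E) :
    ‖v - ∑ i ∈ s, ⟪e i, v⟫ • e i‖ ^ 2 = ‖v‖ ^ 2 - ∑ i ∈ s, ⟪e i, v⟫ ^ 2 := by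
  have h1 : ⟪v, ∑ i ∈ s, ⟪e i, v⟫ • e i⟫ = ∑ i ∈ s, ⟪e i, v⟫ ^ 2 := by
    rw [inner_sum]
    refine Finset.sum_congr rfl fun i _ => ?_
    rw [inner_smul_right, real_inner_comm, sq]
  have h2 : ‖∑ i ∈ s, ⟪e i, v⟫ • e i‖ ^ 2 = ∑ i ∈ s, ⟪e i, v⟫ ^ 2 := by
    rw [← real_inner_self_eq_norm_sq, sum_inner]
    refine Finset.sum_congr rfl fun i hi => ?_
    rw [real_inner_smul_left, he.inner_sum_smul hi, he.inner_mul_norm_sq, sq]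
  rw [norm_sub_sq_real, h1, h2]
  ring

theorem sum_inner_sq_le (he : IsOrthonormalOrZero e) (s : Finset ι) (v : E) :
    ∑ i ∈ s, ⟪e i, v⟫ ^ 2 ≤ ‖v‖ ^ 2 := by
  have := he.norm_sub_sum_sq s v
  nlinarith [sq_nonneg ‖v - ∑ i ∈ s, ⟪e i, v⟫ • e i‖]

/-- The partial expansion `∑ i ∈ s, ⟪e i, v⟫ • e i` approximates `v` at least as well as any
element of the span of the `e i`. -/
theorem norm_sub_sum_le (he : IsOrthonormalOrZero e) (s : Finset ι) (v : E) {w : E}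
    (hw : w ∈ Submodule.span ℝ (e '' s)) :
    ‖v - ∑ i ∈ s, ⟪e i, v⟫ • e i‖ ≤ ‖v - w‖ := by
  have hfix : ∑ i ∈ s, ⟪e i, w⟫ • e i = w := by
    induction hw using Submodule.span_induction with
    | mem x hx =>
      obtain ⟨k, hk, rfl⟩ := hx
      rw [Finset.sum_eq_single_of_mem k hk]
      · rcases he.zero_or_unit k with h | h <;> simp [h]
      · intro j _ hj
        rw [he.inner_eq_zero j k hj, zero_smul]
    | zero => simp
    | add x y _ _ hx hy => simp only [inner_add_right, add_smul, Finset.sum_add_distrib, hx, hy]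
    | smul a x _ hx => simp only [inner_smul_right, mul_smul, ← Finset.smul_sum, hx]
  -- The remainder is linear in `v` and vanishes at `w`, so Bessel's inequality applies to `v - w`.
  have hrem : v - ∑ i ∈ s, ⟪e i, v⟫ • e i
      = (v - w) - ∑ i ∈ s, ⟪e i, v - w⟫ • e i := by
    simp only [inner_sub_right, sub_smul, Finset.sum_sub_distrib, hfix]
    abel
  rw [hrem]
  refine le_of_sq_le_sq ?_ (norm_nonneg _)
  rw [he.norm_sub_sum_sq]
  have : 0 ≤ ∑ i ∈ s, ⟪e i, v - w⟫ ^ 2 := Finset.sum_nonneg fun _ _ => sq_nonneg _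
  linarith

end IsOrthonormalOrZero

/-- A continuous map from a separable space to an inner product space has a countable orthonormal
system, made of finite linear combinations of its values, with respect to which Parseval's
identity holds at each of its values: apply the Gram-Schmidt process along a dense sequence. -/
theorem exists_isOrthonormalOrZero_parseval [SeparableSpace X] [Nonempty X] {φ : X → E}
    (hφ : Continuous φ) :
    ∃ e : ℕ → E, IsOrthonormalOrZero e ∧ (∀ i, e i ∈ Submodule.span ℝ (Set.range φ)) ∧
      ∀ x, Tendsto (fun n => ∑ i ∈ Finset.range n, ⟪e i, φ x⟫ ^ 2) atTop (nhds (‖φ x‖ ^ 2)) := by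
  set v : ℕ → E := fun k => φ (denseSeq X k) with hv
  set e := InnerProductSpace.gramSchmidtNormed ℝ v with hedef
  have he : IsOrthonormalOrZero e := isOrthonormalOrZero_gramSchmidtNormed v
  refine ⟨e, he, fun i => ?_, fun x => ?_⟩
  · have h1 : e i ∈ Submodule.span ℝ (Set.range v) := by
      rw [← InnerProductSpace.span_gramSchmidt ℝ v,
        ← InnerProductSpace.span_gramSchmidtNormed_range]
      exact Submodule.subset_span ⟨i, rfl⟩
    refine Submodule.span_mono ?_ h1
    rintro _ ⟨k, rfl⟩
    exact ⟨_, rfl⟩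
  · have hmem : ∀ k n : ℕ, k < n → v k ∈ Submodule.span ℝ (e '' (Finset.range n : Set ℕ)) := by
      intro k n hkn
      have h1 : v k ∈ Submodule.span ℝ (e '' Set.Iic k) := by
        rw [hedef, InnerProductSpace.span_gramSchmidtNormed, InnerProductSpace.span_gramSchmidt_Iic]
        exact Submodule.subset_span ⟨k, le_refl k, rfl⟩
      refine Submodule.span_mono (Set.image_mono ?_) h1
      intro i hi
      simpa using lt_of_le_of_lt hi hkn
    rw [Metric.tendsto_atTop]
    intro ε hε
    -- A point `denseSeq X k` near `x` belongs to the span from step `k + 1` on.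
    have hopen : IsOpen {x' | ‖φ x - φ x'‖ ^ 2 < ε} :=
      isOpen_lt (by fun_prop) continuous_const
    obtain ⟨k, hk⟩ := (denseRange_denseSeq X).exists_mem_open hopen ⟨x, by simpa using hε⟩
    refine ⟨k + 1, fun n hn => ?_⟩
    have h1 := he.norm_sub_sum_le (Finset.range n) (φ x) (hmem k n hn)
    have h2 := he.norm_sub_sum_sq (Finset.range n) (φ x)
    have h3 : ‖φ x - v k‖ ^ 2 < ε := hk
    have h4 := pow_le_pow_left₀ (norm_nonneg _) h1 2
    rw [Real.dist_eq, abs_sub_lt_iff]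
    constructor
    · linarith [he.sum_inner_sq_le (Finset.range n) (φ x)]
    · linarith

/-! ### Kernels that are products of two kernels -/

/-- If the Gram kernel of `Φ` is the product of those of `φ` and `ψ`, then `Φ` extends to a map
on pairs of vectors of the spans of `φ` and `ψ` that behaves like the tensor product
`span φ ⊗ span ψ → E`. -/
theorem inner_bilinear_lift {α β E₁ E₂ : Type*} [NormedAddCommGroup E₁] [InnerProductSpace ℝ E₁]
    [NormedAddCommGroup E₂] [InnerProductSpace ℝ E₂] {Φ : α × β → E} {φ : α → E₁} {ψ : β → E₂}
    (hΦ : ∀ p q : α × β, ⟪Φ p, Φ q⟫ = ⟪φ p.1, φ q.1⟫ * ⟪ψ p.2, ψ q.2⟫)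
    (a a' : α →₀ ℝ) (b b' : β →₀ ℝ) :
    ⟪Finsupp.linearCombination ℝ
        (fun x => Finsupp.linearCombination ℝ fun y => Φ (x, y)) a b,
      Finsupp.linearCombination ℝ
        (fun x => Finsupp.linearCombination ℝ fun y => Φ (x, y)) a' b'⟫
      = ⟪Finsupp.linearCombination ℝ φ a, Finsupp.linearCombination ℝ φ a'⟫ *
        ⟪Finsupp.linearCombination ℝ ψ b, Finsupp.linearCombination ℝ ψ b'⟫ := by
  induction a using Finsupp.induction_linear with
  | zero => simp
  | add a₁ a₂ h₁ h₂ => simp only [map_add, LinearMap.add_apply, inner_add_left, h₁, h₂, add_mul]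
  | single x r =>
  induction a' using Finsupp.induction_linear with
  | zero => simp
  | add a₁ a₂ h₁ h₂ => simp only [map_add, LinearMap.add_apply, inner_add_right, h₁, h₂, add_mul]
  | single x' r' =>
  induction b using Finsupp.induction_linear with
  | zero => simp
  | add a₁ a₂ h₁ h₂ => simp only [map_add, inner_add_left, h₁, h₂, mul_add]
  | single y s =>
  induction b' using Finsupp.induction_linear with
  | zero => simp
  | add a₁ a₂ h₁ h₂ => simp only [map_add, inner_add_right, h₁, h₂, mul_add]
  | single y' s' =>
    simp only [Finsupp.linearCombination_single, LinearMap.smul_apply, real_inner_smul_left,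
      real_inner_smul_right, hΦ]
    ring

theorem continuous_of_continuous_inner {α : Type*} [TopologicalSpace α] {Φ : α → E}
    (hΦ : Continuous fun r : α × α => ⟪Φ r.1, Φ r.2⟫) : Continuous Φ := by
  refine continuous_iff_continuousAt.2 fun q => tendsto_iff_norm_sub_tendsto_zero.2 ?_
  have hsq : Continuous fun p => ‖Φ p - Φ q‖ ^ 2 := by
    have hpp : Continuous fun p => ⟪Φ p, Φ p⟫ := hΦ.comp (continuous_id.prodMk continuous_id)
    have hpq : Continuous fun p => ⟪Φ p, Φ q⟫ := hΦ.comp (continuous_id.prodMk continuous_const)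
    simp only [norm_sub_sq_real]
    simp only [← real_inner_self_eq_norm_sq]
    fun_prop
  simpa using hsq.sqrt.tendsto q

/-- The Hilbert-space form of `doubleSum`. -/
noncomputable def partialSum (z : ℕ × ℕ → E) (g : ℕ → C(X, ℝ)) (h : ℕ → C(Y, ℝ)) (n : ℕ)
    (p : X × Y) : E :=
  ∑ s ∈ Finset.range n ×ˢ Finset.range n, (g s.1 p.1 * h s.2 p.2) • z s

theorem continuous_partialSum (z : ℕ × ℕ → E) (g : ℕ → C(X, ℝ)) (h : ℕ → C(Y, ℝ)) (n : ℕ) :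
    Continuous (partialSum z g h n) := by
  unfold partialSum
  fun_prop

theorem coeff_eq_zero_of_notMem_activePairs {g : ℕ → C(X, ℝ)} {h : ℕ → C(Y, ℝ)} {s : ℕ × ℕ}
    (hs : s ∉ activePairs g h) (x : X) (y : Y) : g s.1 x * h s.2 y = 0 := by
  by_cases hg : g s.1 = 0
  · simp [hg]
  · have : h s.2 = 0 := by
      by_contra hh
      exact hs ⟨hg, hh⟩
    simp [this]

/-- Karhunen-Loève-type expansion of a map into a Hilbert space whose Gram kernel is a product of
two continuous kernels. With systems `e` and `f` adapted to the factors, the vectors `z (i, j)`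
play the role of `e i ⊗ f j`, and the squared error after `n` steps is
`‖φ x‖² ‖ψ y‖² - (∑ i < n, ⟪e i, φ x⟫²) (∑ j < n, ⟪f j, ψ y⟫²)`, which tends to zero uniformly by
Dini's theorem. -/
theorem exists_partialSum_tendstoUniformly {E₁ E₂ : Type*}
    [NormedAddCommGroup E₁] [InnerProductSpace ℝ E₁]
    [NormedAddCommGroup E₂] [InnerProductSpace ℝ E₂]
    [CompactSpace X] [CompactSpace Y] [SeparableSpace X] [SeparableSpace Y] [Nonempty X]
    [Nonempty Y] {Φ : X × Y → E} {φ : X → E₁} {ψ : Y → E₂}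
    (hφ : Continuous φ) (hψ : Continuous ψ)
    (hΦ : ∀ p q : X × Y, ⟪Φ p, Φ q⟫ = ⟪φ p.1, φ q.1⟫ * ⟪ψ p.2, ψ q.2⟫) :
    ∃ (z : ℕ × ℕ → E) (g : ℕ → C(X, ℝ)) (h : ℕ → C(Y, ℝ)),
      (∀ s, z s ∈ Submodule.span ℝ (Set.range Φ)) ∧
      (∀ s ∈ activePairs g h, ∀ t ∈ activePairs g h, ⟪z s, z t⟫ = if s = t then 1 else 0) ∧
      TendstoUniformly (fun n p => ‖partialSum z g h n p - Φ p‖ ^ 2) (fun _ => 0) atTop := by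
  obtain ⟨e, he, he_span, he_lim⟩ := exists_isOrthonormalOrZero_parseval hφ
  obtain ⟨f, hf, hf_span, hf_lim⟩ := exists_isOrthonormalOrZero_parseval hψ
  choose a ha using fun i => (Finsupp.mem_span_range_iff_exists_finsupp (R := ℝ)).1 (he_span i)
  choose b hb using fun j => (Finsupp.mem_span_range_iff_exists_finsupp (R := ℝ)).1 (hf_span j)
  replace ha : ∀ i, Finsupp.linearCombination ℝ φ (a i) = e i := ha
  replace hb : ∀ j, Finsupp.linearCombination ℝ ψ (b j) = f j := hb
  set B := Finsupp.linearCombination ℝ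
    (fun x => Finsupp.linearCombination ℝ fun y => Φ (x, y)) with hB
  set z : ℕ × ℕ → E := fun s => B (a s.1) (b s.2) with hz
  have hzz : ∀ s t, ⟪z s, z t⟫ = ⟪e s.1, e t.1⟫ * ⟪f s.2, f t.2⟫ := by
    intro s t
    rw [hz, inner_bilinear_lift hΦ, ha, ha, hb, hb]
  have hzΦ : ∀ s p, ⟪z s, Φ p⟫ = ⟪e s.1, φ p.1⟫ * ⟪f s.2, ψ p.2⟫ := by
    intro s p
    have : Φ p = B (Finsupp.single p.1 1) (Finsupp.single p.2 1) := by simp [hB]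
    rw [this, hz, inner_bilinear_lift hΦ, ha, hb]
    simp
  have hz_sys : IsOrthonormalOrZero z := by
    refine ⟨fun s t hst => ?_, fun s => ?_⟩
    · rw [hzz]
      by_cases h1 : s.1 = t.1
      · have h2 : s.2 ≠ t.2 := fun h2 => hst (Prod.ext h1 h2)
        rw [hf.inner_eq_zero _ _ h2, mul_zero]
      · rw [he.inner_eq_zero _ _ h1, zero_mul]
    · have h := hzz s s
      simp only [real_inner_self_eq_norm_sq] at h
      rcases he.zero_or_unit s.1 with h1 | h1
      · left; simpa [h1] using h
      rcases hf.zero_or_unit s.2 with h2 | h2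
      · left; simpa [h2] using h
      · right
        rw [h1, h2] at h
        exact (sq_eq_sq₀ (norm_nonneg _) zero_le_one).1 (by linarith)
  let g : ℕ → C(X, ℝ) := fun i => ⟨fun x => ⟪e i, φ x⟫, by fun_prop⟩
  let h : ℕ → C(Y, ℝ) := fun j => ⟨fun y => ⟪f j, ψ y⟫, by fun_prop⟩
  refine ⟨z, g, h, fun s => ?_, fun s hs t ht => ?_, ?_⟩
  · simp only [hz, hB, Finsupp.linearCombination_apply, Finsupp.sum, LinearMap.sum_apply,
      LinearMap.smul_apply]
    exact Submodule.sum_mem _ fun x _ => Submodule.smul_mem _ _ <|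
      Submodule.sum_mem _ fun y _ => Submodule.smul_mem _ _ <| Submodule.subset_span ⟨(x, y), rfl⟩
  · -- `e i = 0` forces `g i = 0`, so both factors of `z s` are unit vectors at an active pair.
    split_ifs with hst
    · subst hst
      have h1 : e s.1 ≠ 0 := fun h0 => hs.1 (by ext x; simp [g, h0])
      have h2 : f s.2 ≠ 0 := fun h0 => hs.2 (by ext y; simp [h, h0])
      rw [hzz, real_inner_self_eq_norm_sq, real_inner_self_eq_norm_sq,
        (he.zero_or_unit s.1).resolve_left h1, (hf.zero_or_unit s.2).resolve_left h2]
      norm_num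
    · exact hz_sys.inner_eq_zero s t hst
  · have herr : ∀ n p, ‖partialSum z g h n p - Φ p‖ ^ 2 = ‖φ p.1‖ ^ 2 * ‖ψ p.2‖ ^ 2 -
        (∑ i ∈ Finset.range n, ⟪e i, φ p.1⟫ ^ 2) * ∑ j ∈ Finset.range n, ⟪f j, ψ p.2⟫ ^ 2 := by
      intro n p
      have h1 := hz_sys.norm_sub_sum_sq (Finset.range n ×ˢ Finset.range n) (Φ p)
      simp only [hzΦ] at h1
      rw [norm_sub_rev, Finset.sum_mul_sum, ← Finset.sum_product']
      simp only [← mul_pow]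
      refine h1.trans ?_
      congr 1
      rw [← real_inner_self_eq_norm_sq, hΦ, real_inner_self_eq_norm_sq,
        real_inner_self_eq_norm_sq, mul_pow]
    simp only [herr]
    refine Antitone.tendstoUniformly_of_forall_tendsto (fun n => by fun_prop) ?_
      continuous_const fun p => ?_
    · intro m n hmn p
      refine sub_le_sub_left ?_ _
      have hsub : Finset.range m ⊆ Finset.range n := Finset.range_mono hmn
      refine mul_le_mul (Finset.sum_le_sum_of_subset_of_nonneg hsub fun _ _ _ => sq_nonneg _)
        (Finset.sum_le_sum_of_subset_of_nonneg hsub fun _ _ _ => sq_nonneg _)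
        (Finset.sum_nonneg fun _ _ => sq_nonneg _) (Finset.sum_nonneg fun _ _ => sq_nonneg _)
    · rw [← sub_self (‖φ p.1‖ ^ 2 * ‖ψ p.2‖ ^ 2)]
      exact tendsto_const_nhds.sub ((he_lim p.1).mul (hf_lim p.2))

/-- Conversely, a uniform limit of the partial sums is continuous and has a separable Gram
kernel. The kernel of a partial sum is `κx * κy`, hence satisfies
`κ(p, p') κ(q, q') = κ((x, y₀), (x', y₀')) κ((x₀, y), (x₀', y'))` for `p = (x, y)`, `q = (x₀, y₀)`,
`p' = (x', y')`, `q' = (x₀', y₀')`. This identity survives the limit and, read at a point where `κ`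
does not vanish, says that `κ` is separable. -/
theorem continuous_and_isSeparable_of_tendstoUniformly {Φ : X × Y → E} {z : ℕ × ℕ → E}
    {g : ℕ → C(X, ℝ)} {h : ℕ → C(Y, ℝ)}
    (hz : ∀ s ∈ activePairs g h, ∀ t ∈ activePairs g h, ⟪z s, z t⟫ = if s = t then 1 else 0)
    (hlim : TendstoUniformly (fun n p => ‖partialSum z g h n p - Φ p‖ ^ 2) (fun _ => 0) atTop) :
    Continuous Φ ∧ IsSeparable fun p q => ⟪Φ p, Φ q⟫ := by
  have hunif : TendstoUniformly (fun n p => partialSum z g h n p) Φ atTop := by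
    rw [Metric.tendstoUniformly_iff] at hlim ⊢
    intro ε hε
    filter_upwards [hlim (ε ^ 2) (by positivity)] with n hn p
    have := hn p
    rw [dist_zero_left, Real.norm_of_nonneg (sq_nonneg _)] at this
    rw [dist_comm, dist_eq_norm]
    exact lt_of_pow_lt_pow_left₀ 2 hε.le this
  refine ⟨hunif.continuous (Frequently.of_forall fun n => continuous_partialSum z g h n), ?_⟩
  have hker : ∀ n p q, ⟪partialSum z g h n p, partialSum z g h n q⟫ =
      (∑ i ∈ Finset.range n, g i p.1 * g i q.1) * ∑ j ∈ Finset.range n, h j p.2 * h j q.2 := by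
    intro n p q
    rw [Finset.sum_mul_sum, ← Finset.sum_product', partialSum, sum_inner]
    refine Finset.sum_congr rfl fun s hs => ?_
    rw [partialSum, inner_sum, Finset.sum_eq_single_of_mem s hs]
    · rw [real_inner_smul_left, real_inner_smul_right]
      by_cases hsa : s ∈ activePairs g h
      · rw [hz s hsa s hsa, if_pos rfl]
        ring
      · rw [coeff_eq_zero_of_notMem_activePairs hsa]
        linear_combination (-g s.1 q.1 * h s.2 q.2) *
          coeff_eq_zero_of_notMem_activePairs hsa p.1 p.2
    · intro t _ hts
      rw [real_inner_smul_left, real_inner_smul_right]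
      by_cases hsa : s ∈ activePairs g h
      · by_cases hta : t ∈ activePairs g h
        · rw [hz s hsa t hta, if_neg hts.symm]
          simp
        · rw [coeff_eq_zero_of_notMem_activePairs hta]
          simp
      · rw [coeff_eq_zero_of_notMem_activePairs hsa]
        simp
  have hkerlim : ∀ p q, Tendsto
      (fun n => ⟪partialSum z g h n p, partialSum z g h n q⟫) atTop (nhds ⟪Φ p, Φ q⟫) :=
    fun p q => (hunif.tendsto_at p).inner (hunif.tendsto_at q)
  by_cases h0 : ∃ p q, ⟪Φ p, Φ q⟫ ≠ 0
  · obtain ⟨⟨x₀, y₀⟩, ⟨x₀', y₀'⟩, h0⟩ := h0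
    refine ⟨fun x x' => ⟪Φ (x, y₀), Φ (x', y₀')⟫,
      fun y y' => ⟪Φ (x₀, y), Φ (x₀', y')⟫ / ⟪Φ (x₀, y₀), Φ (x₀', y₀')⟫, fun x y x' y' => ?_⟩
    rw [mul_div_assoc', eq_div_iff h0]
    refine tendsto_nhds_unique ((hkerlim (x, y) (x', y')).mul (hkerlim (x₀, y₀) (x₀', y₀'))) ?_
    convert (hkerlim (x, y₀) (x', y₀')).mul (hkerlim (x₀, y) (x₀', y')) using 2 with n
    simp only [hker]
    ring
  · push Not at h0
    exact ⟨fun _ _ => 0, fun _ _ => 0, fun x y x' y' => by simp [h0]⟩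

end Hilbert

section RandomField

variable {Ω X Y : Type*} [MeasurableSpace Ω] {P : Measure Ω} {F : X → Y → Ω → ℝ}

/-! ### The process as a map into `L²` -/

theorem integral_mul_eq_inner {f g : Ω → ℝ} {u v : Lp ℝ 2 P} (hf : f =ᵐ[P] u) (hg : g =ᵐ[P] v) :
    ∫ ω, f ω * g ω ∂P = ⟪u, v⟫ := by
  rw [L2.inner_def]
  refine integral_congr_ae ?_
  filter_upwards [hf, hg] with ω h1 h2
  simp [h1, h2, mul_comm]

theorem coeFn_sum_smul {ι : Type*} (s : Finset ι) (c : ι → ℝ) (z : ι → Lp ℝ 2 P) :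
    ⇑(∑ i ∈ s, c i • z i) =ᵐ[P] fun ω => ∑ i ∈ s, c i * z i ω := by
  classical
  induction s using Finset.induction_on with
  | empty =>
    filter_upwards [Lp.coeFn_zero ℝ 2 P] with ω hω
    simpa using hω
  | insert i s hi ih =>
    rw [Finset.sum_insert hi]
    filter_upwards [Lp.coeFn_add (c i • z i) (∑ j ∈ s, c j • z j), Lp.coeFn_smul (c i) (z i), ih]
      with ω h1 h2 h3
    rw [h1, Pi.add_apply, h2, h3, Finset.sum_insert hi]
    rfl

/-- A variable uncorrelated with a family is uncorrelated with its span; `u = 1` gives the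
centring of linear combinations. -/
theorem integral_mul_eq_zero_of_mem_span {ι : Type*} {Φ : ι → Lp ℝ 2 P} {u : Ω → ℝ}
    (hu : MemLp u 2 P) (h0 : ∀ p, ∫ ω, u ω * Φ p ω ∂P = 0) {z : Lp ℝ 2 P}
    (hz : z ∈ Submodule.span ℝ (Set.range Φ)) : ∫ ω, u ω * z ω ∂P = 0 := by
  have huv (v : Lp ℝ 2 P) : ∫ ω, u ω * v ω ∂P = ⟪hu.toLp u, v⟫ :=
    integral_mul_eq_inner hu.coeFn_toLp.symm (ae_eq_refl _)
  simp only [huv] at h0 ⊢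
  induction hz using Submodule.span_induction with
  | mem x hx =>
    obtain ⟨p, rfl⟩ := hx
    exact h0 p
  | zero => simp
  | add x y _ _ hx hy => rw [inner_add_right, hx, hy, add_zero]
  | smul a x _ hx => rw [inner_smul_right, hx, mul_zero]

namespace IsCentredSecondOrder

/-- The values of the process as elements of `L²`. -/
noncomputable def toL2 (hF : IsCentredSecondOrder P F) (p : X × Y) : Lp ℝ 2 P :=
  (hF.memLp p.1 p.2).toLp (F p.1 p.2)

theorem coeFn_toL2 (hF : IsCentredSecondOrder P F) (p : X × Y) :
    F p.1 p.2 =ᵐ[P] hF.toL2 p :=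
  (hF.memLp p.1 p.2).coeFn_toLp.symm

theorem covFun_eq_inner (hF : IsCentredSecondOrder P F) :
    covFun P F = fun p q => ⟪hF.toL2 p, hF.toL2 q⟫ := by
  funext p q
  rw [← integral_mul_eq_inner (hF.coeFn_toL2 p) (hF.coeFn_toL2 q)]
  simp [covFun, covariance, hF.centred]

theorem integral_eq_zero_of_mem_span [IsFiniteMeasure P] (hF : IsCentredSecondOrder P F)
    {z : Lp ℝ 2 P} (hz : z ∈ Submodule.span ℝ (Set.range hF.toL2)) : ∫ ω, z ω ∂P = 0 := by
  have h := integral_mul_eq_zero_of_mem_span (u := fun _ => 1) (memLp_const 1) (fun p => ?_) hz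
  · simpa using h
  · simp only [one_mul]
    rw [← integral_congr_ae (hF.coeFn_toL2 p), hF.centred]

variable [TopologicalSpace X] [TopologicalSpace Y]

/-- The random variables may be modified at inactive pairs without changing the error of the
partial sums. -/
theorem integral_sq_sub_eq (hF : IsCentredSecondOrder P F) {Z : ℕ → ℕ → Ω → ℝ}
    {z : ℕ × ℕ → Lp ℝ 2 P} {g : ℕ → C(X, ℝ)} {h : ℕ → C(Y, ℝ)}
    (hZ : ∀ s ∈ activePairs g h, Z s.1 s.2 =ᵐ[P] z s) (n : ℕ) (p : X × Y) :
    ∫ ω, (doubleSum Z g h n p.1 p.2 ω - F p.1 p.2 ω) ^ 2 ∂P =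
      ‖partialSum z g h n p - hF.toL2 p‖ ^ 2 := by
  have hall : ∀ᵐ ω ∂P, ∀ s ∈ activePairs g h, Z s.1 s.2 ω = z s ω :=
    (ae_ball_iff (Set.to_countable _)).2 hZ
  have hsum : (fun ω => doubleSum Z g h n p.1 p.2 ω - F p.1 p.2 ω) =ᵐ[P]
      ⇑(partialSum z g h n p - hF.toL2 p) := by
    filter_upwards [hall, hF.coeFn_toL2 p, Lp.coeFn_sub (partialSum z g h n p) (hF.toL2 p),
      coeFn_sum_smul (Finset.range n ×ˢ Finset.range n) (fun s => g s.1 p.1 * h s.2 p.2) z]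
      with ω h1 h2 h3 h4
    rw [h3, Pi.sub_apply, h2, partialSum, h4, doubleSum, ← Finset.sum_product']
    congr 1
    refine Finset.sum_congr rfl fun s _ => ?_
    by_cases hs : s ∈ activePairs g h
    · rw [h1 s hs]
      ring
    · rw [mul_assoc, coeff_eq_zero_of_notMem_activePairs hs]
      ring
  rw [← real_inner_self_eq_norm_sq, ← integral_mul_eq_inner hsum hsum]
  simp only [sq]

/-- Mean-square convergence of the double sums is norm convergence of the partial sums in `L²`. -/
theorem tendstoQMUniformly_iff (hF : IsCentredSecondOrder P F) {Z : ℕ → ℕ → Ω → ℝ}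
    {z : ℕ × ℕ → Lp ℝ 2 P} {g : ℕ → C(X, ℝ)} {h : ℕ → C(Y, ℝ)}
    (hZ : ∀ s ∈ activePairs g h, Z s.1 s.2 =ᵐ[P] z s) :
    TendstoQMUniformly P (doubleSum Z g h) F ↔
      TendstoUniformly (fun n p => ‖partialSum z g h n p - hF.toL2 p‖ ^ 2) (fun _ => 0)
        atTop := by
  simp only [TendstoQMUniformly, hF.integral_sq_sub_eq hZ]

/-- The expansion of `F` in `L²`, with coefficient vectors in the linear span of the process. If
`(x₀, y₀)` is a point of positive variance, then separability makes the kernel the product of those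
of the one-parameter processes `F(·, y₀)` and `F(x₀, ·)`, up to normalisation. -/
theorem exists_expansion (hF : IsCentredSecondOrder P F)
    [CompactSpace X] [CompactSpace Y] [SeparableSpace X] [SeparableSpace Y]
    (hcov : HasContinuousSeparableCov P F) {p₀ : X × Y} (hp₀ : hF.toL2 p₀ ≠ 0) :
    ∃ (z : ℕ × ℕ → Lp ℝ 2 P) (g : ℕ → C(X, ℝ)) (h : ℕ → C(Y, ℝ)),
      (∀ s, z s ∈ Submodule.span ℝ (Set.range hF.toL2)) ∧
      (∀ s ∈ activePairs g h, ∀ t ∈ activePairs g h, ⟪z s, z t⟫ = if s = t then 1 else 0) ∧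
      TendstoUniformly (fun n p => ‖partialSum z g h n p - hF.toL2 p‖ ^ 2) (fun _ => 0)
        atTop := by
  obtain ⟨hcont, κx, κy, hκ⟩ := hcov
  rw [hF.covFun_eq_inner] at hcont hκ
  beta_reduce at hcont hκ
  have hΦ : Continuous hF.toL2 := continuous_of_continuous_inner hcont
  obtain ⟨x₀, y₀⟩ := p₀
  have : Nonempty X := ⟨x₀⟩
  have : Nonempty Y := ⟨y₀⟩
  set N := ‖hF.toL2 (x₀, y₀)‖ with hNdef
  have hN : N ≠ 0 := norm_ne_zero_iff.2 hp₀
  have hN2 : N ^ 2 = κx x₀ x₀ * κy y₀ y₀ := by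
    rw [hNdef, ← real_inner_self_eq_norm_sq]
    exact hκ x₀ y₀ x₀ y₀
  refine exists_partialSum_tendstoUniformly (φ := fun x => hF.toL2 (x, y₀))
    (ψ := fun y => N⁻¹ • hF.toL2 (x₀, y)) (by fun_prop) (by fun_prop) ?_
  rintro ⟨x, y⟩ ⟨x', y'⟩
  simp only [real_inner_smul_left, real_inner_smul_right]
  rw [hκ, hκ, hκ]
  field_simp
  rw [hN2]
  ring

end IsCentredSecondOrder

/-! ### From expansions to the covariance function -/

variable [TopologicalSpace X] [TopologicalSpace Y]

theorem IsOrthonormalOn.mono {Z : ℕ → ℕ → Ω → ℝ} {S T : Set (ℕ × ℕ)}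
    (hZ : IsOrthonormalOn P Z T) (hST : S ⊆ T) : IsOrthonormalOn P Z S where
  memLp s hs := hZ.memLp s (hST hs)
  centred s hs := hZ.centred s (hST hs)
  inner_eq s hs t ht := hZ.inner_eq s (hST hs) t (hST ht)

theorem IsFiniteSumFull.isFiniteSum (hfin : IsFiniteSumFull P F) : IsFiniteSum P F := by
  obtain ⟨n, Z, g, h, hZ, hsum⟩ := hfin
  exact ⟨n, Z, g, h, hZ.mono Set.inter_subset_right, hsum⟩

theorem IsUniformLimitFull.isUniformLimit (hlim : IsUniformLimitFull P F) :
    IsUniformLimit P F := by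
  obtain ⟨Z, g, h, hZ, hsum⟩ := hlim
  exact ⟨Z, g, h, hZ.mono (Set.subset_univ _), hsum⟩

/-- Replacing the coefficient functions with index at least `n` by zero turns a finite sum into an
eventually constant sequence of partial sums. -/
theorem IsFiniteSum.isUniformLimit (hfin : IsFiniteSum P F) : IsUniformLimit P F := by
  obtain ⟨n, Z, g, h, hZ, hsum⟩ := hfin
  let g' : ℕ → C(X, ℝ) := fun i => if i < n then g i else 0
  let h' : ℕ → C(Y, ℝ) := fun j => if j < n then h j else 0
  refine ⟨Z, g', h', hZ.mono ?_, ?_⟩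
  · rintro ⟨i, j⟩ ⟨hi, hj⟩
    have hin : i < n := by
      by_contra hin
      exact hi (if_neg hin)
    have hjn : j < n := by
      by_contra hjn
      exact hj (if_neg hjn)
    simp only [g', h', hin, hjn, if_true] at hi hj
    exact ⟨⟨hi, hj⟩, hin, hjn⟩
  · have htrunc : ∀ m, n ≤ m → doubleSum Z g' h' m = doubleSum Z g h n := by
      intro m hnm
      funext x y ω
      simp only [doubleSum, ← Finset.sum_product']
      refine (Finset.sum_subset (Finset.product_subset_product (Finset.range_mono hnm)
        (Finset.range_mono hnm)) ?_).symm.trans (Finset.sum_congr rfl ?_)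
      · rintro ⟨i, j⟩ _ hij
        simp only [Finset.mem_product, Finset.mem_range, not_and_or] at hij
        rcases hij with hi | hj
        · simp [g', hi]
        · simp [h', hj]
      · rintro ⟨i, j⟩ hij
        simp only [Finset.mem_product, Finset.mem_range] at hij
        simp [g', h', hij.1, hij.2]
    refine Metric.tendstoUniformly_iff.2 fun ε hε => ?_
    filter_upwards [eventually_ge_atTop n] with m hm p
    rw [htrunc m hm, integral_eq_zero_of_ae]
    · simpa using hε
    · filter_upwards [hsum p.1 p.2] with ω hω
      simp [hω]

theorem IsUniformLimit.hasContinuousSeparableCov (hF : IsCentredSecondOrder P F)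
    (hlim : IsUniformLimit P F) : HasContinuousSeparableCov P F := by
  classical
  obtain ⟨Z, g, h, hZ, hsum⟩ := hlim
  let z : ℕ × ℕ → Lp ℝ 2 P := fun s =>
    if hs : s ∈ activePairs g h then (hZ.memLp s hs).toLp (Z s.1 s.2) else 0
  have hzZ : ∀ s ∈ activePairs g h, Z s.1 s.2 =ᵐ[P] z s := by
    intro s hs
    simp only [z, dif_pos hs]
    exact (hZ.memLp s hs).coeFn_toLp.symm
  obtain ⟨hcont, hsep⟩ := continuous_and_isSeparable_of_tendstoUniformly
    (fun s hs t ht => by rw [← integral_mul_eq_inner (hzZ s hs) (hzZ t ht), hZ.inner_eq s hs t ht])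
    ((hF.tendstoQMUniformly_iff hzZ).1 hsum)
  rw [HasContinuousSeparableCov, hF.covFun_eq_inner]
  exact ⟨by fun_prop, hsep⟩

/-! ### From the covariance function to expansions -/

/-- A process with vanishing variance is the empty sum. -/
theorem IsCentredSecondOrder.isFiniteSumFull_of_toL2_eq_zero (hF : IsCentredSecondOrder P F)
    (h0 : ∀ p, hF.toL2 p = 0) : IsFiniteSumFull P F := by
  refine ⟨0, 0, 0, 0, ⟨by simp, by simp, by simp⟩, fun x y => ?_⟩
  have h1 := hF.coeFn_toL2 (x, y)
  rw [h0] at h1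
  filter_upwards [h1, Lp.coeFn_zero ℝ 2 P] with ω h2 h3
  simpa [doubleSum] using h2.trans h3

variable [IsFiniteMeasure P] [CompactSpace X] [CompactSpace Y] [SeparableSpace X] [SeparableSpace Y]

theorem HasContinuousSeparableCov.isUniformLimit (hF : IsCentredSecondOrder P F)
    (hcov : HasContinuousSeparableCov P F) {p₀ : X × Y} (hp₀ : hF.toL2 p₀ ≠ 0) :
    IsUniformLimit P F := by
  obtain ⟨z, g, h, hz_span, hz, hlim⟩ := hF.exists_expansion hcov hp₀
  refine ⟨fun i j => z (i, j), g, h, ⟨fun s _ => Lp.memLp _,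
    fun s _ => hF.integral_eq_zero_of_mem_span (hz_span s), fun s hs t ht => ?_⟩,
    (hF.tendstoQMUniformly_iff fun s _ => ae_eq_refl _).2 hlim⟩
  rw [← hz s hs t ht]
  exact integral_mul_eq_inner (ae_eq_refl _) (ae_eq_refl _)

/-- The coefficients at inactive pairs do not matter, so they may be filled with the additional
orthonormal variables: these are orthogonal to the span of the process, which contains the
coefficients at active pairs. -/
theorem HasContinuousSeparableCov.isUniformLimitFull (hF : IsCentredSecondOrder P F)
    (hcov : HasContinuousSeparableCov P F) {p₀ : X × Y} (hp₀ : hF.toL2 p₀ ≠ 0)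
    (hroom : HasRoom P F) : IsUniformLimitFull P F := by
  classical
  obtain ⟨z, g, h, hz_span, hz, hlim⟩ := hF.exists_expansion hcov hp₀
  obtain ⟨U, hU, hU_cent, hU_orth, hUF⟩ := hroom
  have hUz : ∀ k s, ∫ ω, U k ω * z s ω ∂P = 0 := by
    refine fun k s => integral_mul_eq_zero_of_mem_span (hU k) (fun p => ?_) (hz_span s)
    rw [← hUF k p.1 p.2]
    refine integral_congr_ae ?_
    filter_upwards [hF.coeFn_toL2 p] with ω hω
    rw [hω]
  let Z : ℕ → ℕ → Ω → ℝ := fun i j =>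
    if (i, j) ∈ activePairs g h then z (i, j) else U (Nat.pair i j)
  have hZ_pos : ∀ s ∈ activePairs g h, Z s.1 s.2 = z s := fun s hs => if_pos hs
  have hZ_neg : ∀ s ∉ activePairs g h, Z s.1 s.2 = U (Nat.pair s.1 s.2) := fun s hs => if_neg hs
  refine ⟨Z, g, h, ⟨fun s _ => ?_, fun s _ => ?_, fun s _ t _ => ?_⟩,
    (hF.tendstoQMUniformly_iff fun s hs => by rw [hZ_pos s hs]).2 hlim⟩
  · by_cases hs : s ∈ activePairs g h
    · rw [hZ_pos s hs]
      exact Lp.memLp _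
    · rw [hZ_neg s hs]
      exact hU _
  · by_cases hs : s ∈ activePairs g h
    · rw [hZ_pos s hs]
      exact hF.integral_eq_zero_of_mem_span (hz_span s)
    · rw [hZ_neg s hs]
      exact hU_cent _
  · by_cases hs : s ∈ activePairs g h <;> by_cases ht : t ∈ activePairs g h
    · rw [hZ_pos s hs, hZ_pos t ht, ← hz s hs t ht]
      exact integral_mul_eq_inner (ae_eq_refl _) (ae_eq_refl _)
    · rw [hZ_pos s hs, hZ_neg t ht, if_neg (by rintro rfl; exact ht hs)]
      simpa only [mul_comm] using hUz (Nat.pair t.1 t.2) s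
    · rw [hZ_neg s hs, hZ_pos t ht, if_neg (by rintro rfl; exact hs ht), hUz]
    · rw [hZ_neg s hs, hZ_neg t ht, hU_orth]
      simp only [Nat.pair_eq_pair, Prod.ext_iff]

end RandomField

end SeparableCovariance

theorem proposition3 {Ω : Type*} [MeasurableSpace Ω] (P : Measure Ω) [IsProbabilityMeasure P]
    (a b c d : ℝ) (hab : a ≤ b) (hcd : c ≤ d)
    (F : Set.Icc a b → Set.Icc c d → Ω → ℝ)
    (hF : SeparableCovariance.IsCentredSecondOrder P F) :
    (SeparableCovariance.HasContinuousSeparableCov P F ↔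
      SeparableCovariance.IsFiniteSum P F ∨ SeparableCovariance.IsUniformLimit P F) ∧
    (SeparableCovariance.HasRoom P F →
      (SeparableCovariance.HasContinuousSeparableCov P F ↔
        SeparableCovariance.IsFiniteSumFull P F ∨
          SeparableCovariance.IsUniformLimitFull P F)) := by
  have hback : SeparableCovariance.IsFiniteSum P F ∨ SeparableCovariance.IsUniformLimit P F →
      SeparableCovariance.HasContinuousSeparableCov P F := fun hexp =>
    (hexp.elim (fun hfin => hfin.isUniformLimit) id).hasContinuousSeparableCov hF
  by_cases h0 : ∀ p, hF.toL2 p = 0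
  · have hfull := hF.isFiniteSumFull_of_toL2_eq_zero h0
    exact ⟨⟨fun _ => Or.inl hfull.isFiniteSum, hback⟩,
      fun _ => ⟨fun _ => Or.inl hfull, fun _ => hback (Or.inl hfull.isFiniteSum)⟩⟩
  · push Not at h0
    obtain ⟨p₀, hp₀⟩ := h0
    exact ⟨⟨fun hcov => Or.inr (hcov.isUniformLimit hF hp₀), hback⟩,
      fun hroom => ⟨fun hcov => Or.inr (hcov.isUniformLimitFull hF hp₀ hroom),
        fun hexp => hback (hexp.imp (fun hfin => hfin.isFiniteSum)
          fun hlim => hlim.isUniformLimit)⟩⟩
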